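/- Let $G$ be a finite simple connected graph on $n\geq 3$ vertices. A connected set of $G$ is a nonempty set of vertices that induces a connected subgraph; let $N(G)$ be the number of connected sets of $G$ and, for a vertex $v$, let $N(G;v)$ be the number of connected sets containing $v$. A diametral path is a shortest path between two vertices at distance $\operatorname{diam}(G)$. Then there is a vertex $v$ of $G$, which is an endpoint of a diametral path, such that $G-v$ is connected and \[N(G;v)\geq\frac{2N(G)}{n+1},\] where, for this $v$, equality holds if and only if $G$ is a path. Moreover, for every diametral path of $G$, at least one of its two endpoints is such a vertex $v$. -/

import Mathlib

namespace SimpleGraph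

variable {V : Type*} (G : SimpleGraph V)

/-- A connected set: a nonempty vertex set whose induced subgraph is connected
(`SimpleGraph.Connected` includes nonemptiness). -/
def IsConnectedSet (S : Finset V) : Prop :=
  (G.induce (S : Set V)).Connected

open Classical in
/-- The family of all connected sets of `G`. -/
noncomputable def connectedSets [Fintype V] : Finset (Finset V) :=
  Finset.univ.filter fun S => G.IsConnectedSet S

/-- `N(G)`, the number of connected sets of `G`. -/
noncomputable def numConnectedSets [Fintype V] : ℕ :=
  G.connectedSets.card

open Classical in
/-- `N(G; v)`, the number of connected sets of `G` that contain `v`. -/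
noncomputable def numConnectedSetsAt [Fintype V] (v : V) : ℕ :=
  (G.connectedSets.filter fun S => v ∈ S).card

/-- `G` is a path: it is isomorphic to the path graph on its number of vertices. -/
def IsPathGraph [Fintype V] : Prop :=
  Nonempty (G ≃g pathGraph (Fintype.card V))

variable {G} in
/-- A diametral path: a shortest path between two vertices at distance `diam G`. -/
def Walk.IsDiametral {u w : V} (P : G.Walk u w) : Prop :=
  P.IsPath ∧ P.length = G.dist u w ∧ G.dist u w = G.diam

end SimpleGraph

/-!
Fix a diametral path `P` from `u` to `w`, of length `D`. Every connected set meeting `P` arises in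
exactly one way from a connected set `T` containing both `u` and `w` by deleting the first `a` and
the last `b` vertices of `P`, and for fixed `T` the admissible pairs `(a, b)` form a Young diagram.
Its size is the number of connected sets obtained from `T`, while the lengths of its first row and
first column are the numbers of those containing `u` and `w`. A connected set avoiding `P` is joined
to `P` by a shortest path, whose length `c` and the resulting union `T` determine it, so that at
most `min D |T \ P|` of these are charged to `T`.

Since `P` is shortest, an intermediate value argument with the distance from `u` bounds the sum of
the first row and the first column of the diagram of `T ≠ P` by `D + 3 + |T \ P|`. Together with the
arithmetic-geometric mean inequality for the diagram this shows that `n + 1` times that sum is at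
least four times the number of sets charged to `T`, unless `T` is the whole vertex set; and that
deficit is smaller than the excess of `T = P`. Summing over `T`, the average of `N(G; u)` and
`N(G; w)` exceeds `2 N(G) / (n + 1)` unless `P` covers `G`.
-/

section DiametralPath

open SimpleGraph Finset

section YoungDiagram

variable (μ : YoungDiagram)

lemma youngDiagram_card_eq_sum_rowLen : μ.card = ∑ i ∈ range (μ.colLen 0), μ.rowLen i := by
  have hcol : ∀ c ∈ μ.cells, c.1 ∈ range (μ.colLen 0) := fun c hc =>
    mem_range.mpr (YoungDiagram.mem_iff_lt_colLen.mp (μ.up_left_mem le_rfl (Nat.zero_le c.2) hc))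
  rw [YoungDiagram.card, card_eq_sum_card_fiberwise hcol]
  exact sum_congr rfl fun i _ => (μ.rowLen_eq_card).symm

lemma four_mul_youngDiagram_card_le_sq :
    4 * μ.card ≤ (μ.colLen 0 + μ.rowLen 0) ^ 2 := by
  have hbox : μ.card ≤ μ.colLen 0 * μ.rowLen 0 := by
    rw [youngDiagram_card_eq_sum_rowLen]
    simpa using sum_le_card_nsmul (range (μ.colLen 0)) μ.rowLen (μ.rowLen 0)
      fun i _ => μ.rowLen_anti 0 i (Nat.zero_le i)
  calc 4 * μ.card ≤ 4 * μ.colLen 0 * μ.rowLen 0 := by rw [mul_assoc]; gcongr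
    _ ≤ (μ.colLen 0 + μ.rowLen 0) ^ 2 := four_mul_le_sq_add _ _

variable {μ}

-- The last row is short: its cells `(i, j)` have `i` maximal and `i + j ≤ D`.
lemma four_mul_youngDiagram_card_add_le {D : ℕ} (h0 : (0, 0) ∈ μ)
    (hD : ∀ i j, (i, j) ∈ μ → i + j ≤ D) :
    4 * (μ.card + (μ.colLen 0 + μ.rowLen 0)) ≤
      (μ.colLen 0 + μ.rowLen 0) ^ 2 + 4 * (D + 2) := by
  obtain ⟨a, ha⟩ := Nat.exists_eq_succ_of_ne_zero (YoungDiagram.mem_iff_lt_colLen.mp h0).ne'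
  have hrow : 1 ≤ μ.rowLen a := by
    rw [Nat.one_le_iff_ne_zero, ← Nat.pos_iff_ne_zero, ← YoungDiagram.mem_iff_lt_rowLen,
      YoungDiagram.mem_iff_lt_colLen]
    omega
  have hlast : a + (μ.rowLen a - 1) ≤ D :=
    hD _ _ (YoungDiagram.mem_iff_lt_rowLen.mpr (by omega))
  have hinit : ∑ i ∈ range a, μ.rowLen i ≤ a * μ.rowLen 0 := by
    simpa using sum_le_card_nsmul (range a) μ.rowLen (μ.rowLen 0)
      fun i _ => μ.rowLen_anti 0 i (Nat.zero_le i)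
  have hcard : μ.card + (μ.colLen 0 + μ.rowLen 0) ≤ μ.colLen 0 * μ.rowLen 0 + (D + 2) := by
    rw [youngDiagram_card_eq_sum_rowLen, ha, sum_range_succ, Nat.succ_mul]
    omega
  have hsq := four_mul_le_sq_add (μ.colLen 0) (μ.rowLen 0)
  linarith

lemma rowLen_zero_eq_of_mem_iff_add_lt {n : ℕ} (hμ : ∀ i j, (i, j) ∈ μ ↔ i + j < n) :
    μ.rowLen 0 = n :=
  eq_of_forall_lt_iff fun j => by rw [← YoungDiagram.mem_iff_lt_rowLen, hμ, zero_add]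

lemma colLen_zero_eq_of_mem_iff_add_lt {n : ℕ} (hμ : ∀ i j, (i, j) ∈ μ ↔ i + j < n) :
    μ.colLen 0 = n :=
  eq_of_forall_lt_iff fun i => by rw [← YoungDiagram.mem_iff_lt_colLen, hμ, add_zero]

lemma two_mul_card_eq_of_mem_iff_add_lt {n : ℕ} (hμ : ∀ i j, (i, j) ∈ μ ↔ i + j < n) :
    2 * μ.card = n * (n + 1) := by
  have hrow : ∀ i, μ.rowLen i = n - i := fun i => eq_of_forall_lt_iff fun j => by
    rw [← YoungDiagram.mem_iff_lt_rowLen, hμ]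
    omega
  simp only [youngDiagram_card_eq_sum_rowLen, colLen_zero_eq_of_mem_iff_add_lt hμ, hrow]
  clear hrow hμ
  induction n with
  | zero => rfl
  | succ n ih =>
    simp only [sum_range_succ', Nat.add_sub_add_right, Nat.sub_zero, mul_add, ih]
    ring

end YoungDiagram

variable {V : Type*} {G : SimpleGraph V}

section Distance

variable {u w : V} {P : G.Walk u w}

lemma dist_le_dist_add_one_of_adj (hG : G.Connected) (u : V) {x y : V} (hxy : G.Adj x y) :
    G.dist u y ≤ G.dist u x + 1 :=
  hG.dist_triangle.trans_eq (by rw [dist_eq_one_iff_adj.mpr hxy])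

lemma dist_getVert_of_length_eq_dist (hP : P.length = G.dist u w) {i : ℕ} (hi : i ≤ P.length) :
    G.dist u (P.getVert i) = i := by
  rw [← length_eq_dist_of_subwalk hP (P.isSubwalk_take i), Walk.take_length, min_eq_left hi]

lemma dist_add_dist_of_mem_support (hP : P.length = G.dist u w) {x : V} (hx : x ∈ P.support) :
    G.dist u x + G.dist x w = G.dist u w := by
  classical
  rw [← length_eq_dist_of_subwalk hP (P.isSubwalk_takeUntil hx),
    ← length_eq_dist_of_subwalk hP (P.isSubwalk_dropUntil hx), ← hP,
    ← Walk.length_append, P.take_spec]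

lemma adj_getVert_iff_of_length_eq_dist (hG : G.Connected) (hP : P.length = G.dist u w) {i j : ℕ}
    (hi : i ≤ P.length) (hj : j ≤ P.length) :
    G.Adj (P.getVert i) (P.getVert j) ↔ i + 1 = j ∨ j + 1 = i := by
  constructor
  · intro hij
    have hle := dist_le_dist_add_one_of_adj hG u hij
    have hge := dist_le_dist_add_one_of_adj hG u hij.symm
    rw [dist_getVert_of_length_eq_dist hP hi, dist_getVert_of_length_eq_dist hP hj] at hle hge
    have hne : i ≠ j := fun h => hij.ne (h ▸ rfl)
    omega
  · rintro (rfl | rfl)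
    · exact P.adj_getVert_succ hj
    · exact (P.adj_getVert_succ hi).symm

lemma connected_induce_compl_singleton_of_dist_le (hG : G.Connected) {x y : V} (hxy : x ≠ y)
    (hfar : ∀ z, G.dist x z ≤ G.dist x y) : (G.induce ({y}ᶜ : Set V)).Connected := by
  refine induce_connected_of_patches x (by simpa using hxy) fun {z} hz => ?_
  obtain ⟨q, hq⟩ := hG.exists_walk_length_eq_dist x z
  refine ⟨{t | t ∈ q.support}, ?_, q.start_mem_support, q.end_mem_support,
    q.connected_induce_support _ _⟩
  rintro t ht rfl
  have hsum := dist_add_dist_of_mem_support hq ht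
  have hzero : G.dist t z = 0 := by
    have := hfar z
    omega
  exact hz (hG.dist_eq_zero_iff.mp hzero).symm

lemma exists_forall_dist_le {S T : Finset V} (hS : S.Nonempty) (hT : T.Nonempty) :
    ∃ x ∈ S, ∃ y ∈ T, ∀ z ∈ S, ∀ t ∈ T, G.dist x y ≤ G.dist z t := by
  obtain ⟨⟨x, y⟩, hxy, hmin⟩ := exists_min_image (S ×ˢ T) (fun z => G.dist z.1 z.2) (hS.product hT)
  obtain ⟨hx, hy⟩ := mem_product.mp hxy
  exact ⟨x, hx, y, hy, fun z hz t ht => hmin (z, t) (mem_product.mpr ⟨hz, ht⟩)⟩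

end Distance

section ConnectedSets

lemma nonempty_of_isConnectedSet {S : Finset V} (hS : G.IsConnectedSet S) : S.Nonempty :=
  coe_nonempty.mp (Set.nonempty_coe_sort.mp hS.nonempty)

lemma isConnectedSet_singleton (x : V) : G.IsConnectedSet {x} := by
  rw [IsConnectedSet, coe_singleton, induce_singleton_eq_top]
  exact connected_top

lemma isConnectedSet_univ [Fintype V] (hG : G.Connected) : G.IsConnectedSet univ := by
  rw [IsConnectedSet, coe_univ]
  exact (induceUnivIso G).connected_iff.mpr hG

lemma mem_connectedSets [Fintype V] {S : Finset V} : S ∈ G.connectedSets ↔ G.IsConnectedSet S := by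
  simp [connectedSets]

lemma numConnectedSetsAt_eq_card_filter [Fintype V] [DecidableEq V] (x : V) :
    G.numConnectedSetsAt x = #{S ∈ G.connectedSets | x ∈ S} := by
  rw [numConnectedSetsAt]
  congr

lemma exists_mem_apply_eq_of_isConnectedSet {S : Finset V} (hS : G.IsConnectedSet S) {f : V → ℕ}
    (hf : ∀ x y, G.Adj x y → f y ≤ f x + 1) {x y : V} (hx : x ∈ S) (hy : y ∈ S) {t : ℕ}
    (hxt : f x ≤ t) (hty : t ≤ f y) : ∃ z ∈ S, f z = t := by
  obtain hxt | rfl := hxt.lt_or_eq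
  · obtain ⟨p⟩ := hS.preconnected ⟨x, hx⟩ ⟨y, hy⟩
    obtain ⟨d, -, hd, hd'⟩ := p.exists_boundary_dart {z | f z < t} hxt hty.not_gt
    refine ⟨d.snd, d.snd.2, le_antisymm ?_ (not_lt.mp hd')⟩
    exact (hf _ _ d.adj).trans hd
  · exact ⟨x, hx, rfl⟩

variable [DecidableEq V]

lemma isConnectedSet_union {S T : Finset V} (hS : G.IsConnectedSet S) (hT : G.IsConnectedSet T)
    {x : V} (hxS : x ∈ S) (hxT : x ∈ T) : G.IsConnectedSet (S ∪ T) := by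
  rw [IsConnectedSet, coe_union]
  exact induce_union_connected hS.preconnected hT.preconnected ⟨x, hxS, hxT⟩

lemma isConnectedSet_support {u w : V} (p : G.Walk u w) :
    G.IsConnectedSet p.support.toFinset := by
  rw [IsConnectedSet, List.coe_toFinset]
  exact p.connected_induce_support

lemma isConnectedSet_insert_of_adj {S : Finset V} (hS : G.IsConnectedSet S) {x y : V}
    (hy : y ∈ S) (hxy : G.Adj x y) : G.IsConnectedSet (insert x S) := by
  rw [IsConnectedSet, coe_insert, Set.insert_eq]
  refine connected_induce_union ?_ hS.preconnected (Set.mem_singleton x) hy hxy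
  simp

end ConnectedSets

section Trim

variable [DecidableEq V] {u w : V} {P : G.Walk u w} {S T : Finset V} {a b k : ℕ}

/-- The first `a` vertices of a walk. -/
def initialVerts (P : G.Walk u w) (a : ℕ) : Finset V := (range a).image P.getVert

lemma mem_initialVerts {x : V} : x ∈ initialVerts P a ↔ ∃ i < a, P.getVert i = x := by
  simp only [initialVerts, mem_image, mem_range]

lemma initialVerts_succ (P : G.Walk u w) (a : ℕ) :
    initialVerts P (a + 1) = insert (P.getVert a) (initialVerts P a) := by
  rw [initialVerts, initialVerts, range_add_one, image_insert]

lemma initialVerts_mono (P : G.Walk u w) : Monotone (initialVerts P) :=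
  fun _ _ hab => image_subset_image (range_mono hab)

lemma getVert_mem_initialVerts_iff (hP : P.IsPath) (hk : k ≤ P.length) (ha : a ≤ P.length + 1) :
    P.getVert k ∈ initialVerts P a ↔ k < a := by
  rw [mem_initialVerts]
  refine ⟨?_, fun hka => ⟨k, hka, rfl⟩⟩
  rintro ⟨i, hi, hik⟩
  rwa [← hP.getVert_injOn (Set.mem_ofPred_eq ▸ (by omega : i ≤ P.length)) hk hik]

lemma getVert_mem_initialVerts_reverse_iff (hP : P.IsPath) (hk : k ≤ P.length)
    (hb : b ≤ P.length + 1) :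
    P.getVert k ∈ initialVerts P.reverse b ↔ P.length < k + b := by
  rw [← P.length_reverse] at hb
  have h := getVert_mem_initialVerts_iff (P := P.reverse) (k := P.length - k) hP.reverse
    (by rw [P.length_reverse]; omega) hb
  rw [P.getVert_reverse, Nat.sub_sub_self hk] at h
  rw [h]
  omega

/-- The set left from `T` after deleting the first `a` and the last `b` vertices of the walk `P`. -/
def trim (P : G.Walk u w) (T : Finset V) (a b : ℕ) : Finset V :=
  T \ (initialVerts P a ∪ initialVerts P.reverse b)

lemma trim_reverse : trim P.reverse T b a = trim P T a b := by
  rw [trim, trim, P.reverse_reverse, union_comm]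

lemma trim_zero_zero : trim P T 0 0 = T := by simp [trim, initialVerts]

lemma getVert_mem_trim (hP : P.IsPath) (hk : k ≤ P.length) (hab : a + b ≤ P.length) :
    P.getVert k ∈ trim P T a b ↔ P.getVert k ∈ T ∧ a ≤ k ∧ k + b ≤ P.length := by
  rw [trim, mem_sdiff, mem_union, getVert_mem_initialVerts_iff hP hk (by omega),
    getVert_mem_initialVerts_reverse_iff hP hk (by omega), not_or, not_lt, not_lt]

/-- `T` contains the first `a + 1` and the last `b + 1` vertices of the walk `P`, and is still a
connected set once the first `a` and the last `b` of them are deleted. The set of such pairs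
`(a, b)` is what is counted in order to enumerate the connected sets meeting `P`. -/
structure IsTrimmable (P : G.Walk u w) (T : Finset V) (a b : ℕ) : Prop where
  add_le : a + b ≤ P.length
  left : initialVerts P (a + 1) ⊆ T
  right : initialVerts P.reverse (b + 1) ⊆ T
  connected : G.IsConnectedSet (trim P T a b)

lemma isTrimmable_zero_zero : IsTrimmable P T 0 0 ↔ G.IsConnectedSet T ∧ u ∈ T ∧ w ∈ T := by
  refine ⟨fun h => ⟨?_, ?_, ?_⟩, fun ⟨hT, hu, hw⟩ => ⟨Nat.zero_le _, ?_, ?_, ?_⟩⟩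
  · simpa only [trim_zero_zero] using h.connected
  · simpa [initialVerts] using h.left
  · simpa [initialVerts] using h.right
  · simpa [initialVerts] using hu
  · simpa [initialVerts] using hw
  · simpa only [trim_zero_zero] using hT

namespace IsTrimmable

lemma reverse (h : IsTrimmable P T a b) : IsTrimmable P.reverse T b a where
  add_le := by rw [P.length_reverse, add_comm]; exact h.add_le
  left := h.right
  right := by rw [P.reverse_reverse]; exact h.left
  connected := by rw [trim_reverse]; exact h.connected

lemma getVert_mem_trim_left (hP : P.IsPath) (h : IsTrimmable P T a b) :
    P.getVert a ∈ trim P T a b :=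
  (getVert_mem_trim hP (by linarith [h.add_le]) h.add_le).mpr
    ⟨h.left (mem_initialVerts.mpr ⟨a, a.lt_succ_self, rfl⟩), le_rfl, h.add_le⟩

lemma of_succ_left (hP : P.IsPath) (h : IsTrimmable P T (a + 1) b) : IsTrimmable P T a b := by
  have hlen := h.add_le
  have hleft : initialVerts P (a + 1) ⊆ T := (initialVerts_mono P (a + 1).le_succ).trans h.left
  refine ⟨by omega, hleft, h.right, ?_⟩
  have hmem : P.getVert a ∈ trim P T a b := (getVert_mem_trim hP (by omega) (by omega)).mpr
    ⟨hleft (mem_initialVerts.mpr ⟨a, a.lt_succ_self, rfl⟩), le_rfl, by omega⟩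
  have hinsert : trim P T a b = insert (P.getVert a) (trim P T (a + 1) b) := by
    have herase : trim P T (a + 1) b = (trim P T a b).erase (P.getVert a) := by
      rw [trim, trim, initialVerts_succ, insert_union, sdiff_insert]
    rw [herase, insert_erase hmem]
  rw [hinsert]
  exact isConnectedSet_insert_of_adj h.connected (h.getVert_mem_trim_left hP)
    (P.adj_getVert_succ (by omega))

lemma of_succ_right (hP : P.IsPath) (h : IsTrimmable P T a (b + 1)) : IsTrimmable P T a b := by
  simpa only [P.reverse_reverse] using (of_succ_left hP.reverse h.reverse).reverse

lemma of_le (hP : P.IsPath) (h : IsTrimmable P T a b) {a' b' : ℕ} (ha : a' ≤ a) (hb : b' ≤ b) :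
    IsTrimmable P T a' b' :=
  Nat.decreasingInduction (motive := fun i _ => IsTrimmable P T i b')
    (fun _ _ => of_succ_left hP)
    (Nat.decreasingInduction (motive := fun j _ => IsTrimmable P T a j)
      (fun _ _ => of_succ_right hP) h hb) ha

lemma le_of_trim_eq (hP : P.IsPath) {T' : Finset V} {a' b' : ℕ} (h : IsTrimmable P T a b)
    (h' : IsTrimmable P T' a' b') (heq : trim P T a b = trim P T' a' b') : a' ≤ a := by
  have hmem := h.getVert_mem_trim_left hP
  rw [heq, getVert_mem_trim hP (by linarith [h.add_le]) h'.add_le] at hmem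
  exact hmem.2.1

lemma eq_trim_union (h : IsTrimmable P T a b) :
    T = trim P T a b ∪ (initialVerts P a ∪ initialVerts P.reverse b) :=
  (sdiff_union_of_subset (union_subset ((initialVerts_mono P a.le_succ).trans h.left)
    ((initialVerts_mono P.reverse b.le_succ).trans h.right))).symm

lemma eq_of_trim_eq (hP : P.IsPath) {T' : Finset V} {a' b' : ℕ} (h : IsTrimmable P T a b)
    (h' : IsTrimmable P T' a' b') (heq : trim P T a b = trim P T' a' b') :
    T = T' ∧ a = a' ∧ b = b' := by
  have ha : a = a' := le_antisymm (le_of_trim_eq hP h' h heq.symm) (le_of_trim_eq hP h h' heq)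
  have hb : b = b' := by
    rw [← trim_reverse, ← trim_reverse (P := P)] at heq
    exact le_antisymm (le_of_trim_eq hP.reverse h'.reverse h.reverse heq.symm)
      (le_of_trim_eq hP.reverse h.reverse h'.reverse heq)
  refine ⟨?_, ha, hb⟩
  rw [h.eq_trim_union, h'.eq_trim_union, heq, ha, hb]

end IsTrimmable

lemma exists_getVert_mem_disjoint_initialVerts (P : G.Walk u w) (hS : ∃ x ∈ S, x ∈ P.support) :
    ∃ a ≤ P.length, P.getVert a ∈ S ∧ Disjoint S (initialVerts P a) := by
  have hex : ∃ i, P.getVert i ∈ S := by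
    obtain ⟨x, hxS, hx⟩ := hS
    obtain ⟨i, rfl, -⟩ := Walk.mem_support_iff_exists_getVert.mp hx
    exact ⟨i, hxS⟩
  refine ⟨Nat.find hex, ?_, Nat.find_spec hex, ?_⟩
  · obtain ⟨x, hxS, hx⟩ := hS
    obtain ⟨i, rfl, hi⟩ := Walk.mem_support_iff_exists_getVert.mp hx
    exact (Nat.find_min' hex hxS).trans hi
  · rw [disjoint_right]
    intro x hx
    obtain ⟨i, hi, rfl⟩ := mem_initialVerts.mp hx
    exact Nat.find_min hex hi

lemma exists_isTrimmable_trim_eq (hP : P.IsPath) (hS : G.IsConnectedSet S)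
    (hmeet : ∃ x ∈ S, x ∈ P.support) : ∃ T a b, IsTrimmable P T a b ∧ trim P T a b = S := by
  obtain ⟨a, ha, haS, haD⟩ := exists_getVert_mem_disjoint_initialVerts P hmeet
  obtain ⟨b, hb, hbS, hbD⟩ := exists_getVert_mem_disjoint_initialVerts P.reverse
    (by simpa only [P.support_reverse, List.mem_reverse] using hmeet)
  rw [P.length_reverse] at hb
  have hab : a + b ≤ P.length := by
    rw [P.getVert_reverse] at hbS
    have hnot := mt (getVert_mem_initialVerts_iff hP (P.length.sub_le b) (by omega)).mpr
      (disjoint_left.mp haD hbS)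
    omega
  set T := S ∪ (initialVerts P a ∪ initialVerts P.reverse b) with hT
  have htrim : trim P T a b = S := by
    rw [trim, hT, union_sdiff_right, sdiff_eq_self_of_disjoint]
    exact disjoint_union_right.mpr ⟨haD, hbD⟩
  refine ⟨T, a, b, ⟨hab, ?_, ?_, htrim.symm ▸ hS⟩, htrim⟩
  · rw [initialVerts_succ, insert_subset_iff]
    exact ⟨mem_union_left _ haS, fun x hx => mem_union_right _ (mem_union_left _ hx)⟩
  · rw [initialVerts_succ, insert_subset_iff]
    exact ⟨mem_union_left _ hbS, fun x hx => mem_union_right _ (mem_union_right _ hx)⟩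

open Classical in
/-- The pairs `(a, b)` for which `T` is trimmable, as a Young diagram. Its first row and first
column enumerate the pairs whose trimmed set still contains `u` and `w` respectively. -/
noncomputable def trimDiagram (hP : P.IsPath) (T : Finset V) : YoungDiagram where
  cells := {x ∈ range (P.length + 1) ×ˢ range (P.length + 1) | IsTrimmable P T x.1 x.2}
  isLowerSet := by
    rintro ⟨a, b⟩ ⟨a', b'⟩ ⟨ha, hb⟩ hmem
    rw [mem_coe, mem_filter, mem_product, mem_range, mem_range] at hmem ⊢
    exact ⟨⟨ha.trans_lt hmem.1.1, hb.trans_lt hmem.1.2⟩, hmem.2.of_le hP ha hb⟩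

lemma mem_trimDiagram (hP : P.IsPath) : (a, b) ∈ trimDiagram hP T ↔ IsTrimmable P T a b := by
  classical
  rw [← YoungDiagram.mem_cells, trimDiagram, mem_filter, mem_product, mem_range, mem_range]
  refine and_iff_right_of_imp fun h => ?_
  have := h.add_le
  exact ⟨by omega, by omega⟩

lemma trimDiagram_reverse (hP : P.IsPath) :
    trimDiagram hP.reverse T = (trimDiagram hP T).transpose := by
  ext ⟨b, a⟩
  rw [YoungDiagram.mem_cells, YoungDiagram.mem_cells, YoungDiagram.mem_transpose, Prod.swap,
    mem_trimDiagram, mem_trimDiagram]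
  exact ⟨fun h => by simpa only [P.reverse_reverse] using h.reverse, IsTrimmable.reverse⟩

end Trim

section Counting

variable [Fintype V] [DecidableEq V] {u w : V} {P : G.Walk u w} {S T : Finset V}

/-- The connected sets of `G` containing both `u` and `w`. -/
noncomputable def spanningSets (G : SimpleGraph V) (u w : V) : Finset (Finset V) :=
  {T ∈ G.connectedSets | u ∈ T ∧ w ∈ T}

lemma mem_spanningSets : T ∈ spanningSets G u w ↔ G.IsConnectedSet T ∧ u ∈ T ∧ w ∈ T := by
  rw [spanningSets, mem_filter, mem_connectedSets]

lemma spanningSets_comm (u w : V) : spanningSets G u w = spanningSets G w u := by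
  simp only [spanningSets, and_comm]

lemma IsTrimmable.mem_spanningSets (hP : P.IsPath) {a b : ℕ} (h : IsTrimmable P T a b) :
    T ∈ spanningSets G u w :=
  _root_.mem_spanningSets.mpr
    (isTrimmable_zero_zero.mp (h.of_le hP (Nat.zero_le a) (Nat.zero_le b)))

lemma card_filter_connectedSets_eq_sum (hP : P.IsPath) {p : ℕ × ℕ → Prop} [DecidablePred p]
    {q : Finset V → Prop} [DecidablePred q] (hq : ∀ S, q S → ∃ x ∈ S, x ∈ P.support)
    (hpq : ∀ {T a b}, IsTrimmable P T a b → (q (trim P T a b) ↔ p (a, b))) :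
    #{S ∈ G.connectedSets | q S} =
      ∑ T ∈ spanningSets G u w, #{x ∈ (trimDiagram hP T).cells | p x} := by
  rw [← card_sigma]
  symm
  refine card_bij (fun x _ => trim P x.1 x.2.1 x.2.2) ?_ ?_ ?_
  · rintro ⟨T, a, b⟩ h
    rw [mem_sigma, mem_filter, YoungDiagram.mem_cells, mem_trimDiagram] at h
    exact mem_filter.mpr ⟨mem_connectedSets.mpr h.2.1.connected, (hpq h.2.1).mpr h.2.2⟩
  · rintro ⟨T, a, b⟩ h ⟨T', a', b'⟩ h' heq
    rw [mem_sigma, mem_filter, YoungDiagram.mem_cells, mem_trimDiagram] at h h'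
    obtain ⟨rfl, rfl, rfl⟩ := h.2.1.eq_of_trim_eq hP h'.2.1 heq
    rfl
  · intro S hS
    rw [mem_filter, mem_connectedSets] at hS
    obtain ⟨T, a, b, h, rfl⟩ := exists_isTrimmable_trim_eq hP hS.1 (hq S hS.2)
    refine ⟨⟨T, a, b⟩, ?_, rfl⟩
    rw [mem_sigma, mem_filter, YoungDiagram.mem_cells, mem_trimDiagram]
    exact ⟨h.mem_spanningSets hP, h, (hpq h).mp hS.2⟩

lemma card_connectedSets_meeting_eq_sum (hP : P.IsPath) :
    #{S ∈ G.connectedSets | ∃ x ∈ S, x ∈ P.support} =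
      ∑ T ∈ spanningSets G u w, (trimDiagram hP T).card := by
  rw [card_filter_connectedSets_eq_sum hP (p := fun _ => True) (fun _ => id) fun {T a b} h =>
    iff_true_intro ⟨_, h.getVert_mem_trim_left hP, P.getVert_mem_support a⟩]
  simp only [filter_true, YoungDiagram.card]

lemma numConnectedSetsAt_eq_sum_rowLen (hP : P.IsPath) :
    G.numConnectedSetsAt u = ∑ T ∈ spanningSets G u w, (trimDiagram hP T).rowLen 0 := by
  rw [numConnectedSetsAt_eq_card_filter, card_filter_connectedSets_eq_sum hP (p := (·.1 = 0))
    (fun S hu => ⟨u, hu, P.start_mem_support⟩) fun {T a b} h => ?_]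
  · exact sum_congr rfl fun T _ => ((trimDiagram hP T).rowLen_eq_card).symm
  · have hu := getVert_mem_trim (T := T) hP (Nat.zero_le _) h.add_le
    rw [P.getVert_zero] at hu
    have := h.add_le
    have huT : u ∈ T := (isTrimmable_zero_zero.mp (h.of_le hP a.zero_le b.zero_le)).2.1
    rw [hu, and_iff_right huT]
    omega

lemma numConnectedSetsAt_eq_sum_colLen (hP : P.IsPath) :
    G.numConnectedSetsAt w = ∑ T ∈ spanningSets G u w, (trimDiagram hP T).colLen 0 := by
  rw [numConnectedSetsAt_eq_sum_rowLen hP.reverse, spanningSets_comm]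
  simp only [trimDiagram_reverse hP, YoungDiagram.rowLen_transpose]

-- `S` is joined to `P` by a shortest connecting path; it is recovered from the union as the
-- set of vertices whose distance to `P` is at least the length `c` of that path.
lemma exists_spanningSet_of_forall_notMem_support (hG : G.Connected) (hS : G.IsConnectedSet S)
    (havoid : ∀ x ∈ S, x ∉ P.support) :
    ∃ T ∈ spanningSets G u w, P.support.toFinset ⊆ T ∧ ∃ c, (∃ x y, G.dist x y = c) ∧ 1 ≤ c ∧
      c ≤ #(T \ P.support.toFinset) ∧ {z ∈ T | ∀ y ∈ P.support, c ≤ G.dist z y} = S := by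
  obtain ⟨x, hx, y, hy, hmin⟩ := exists_forall_dist_le (G := G) (nonempty_of_isConnectedSet hS)
    (nonempty_of_isConnectedSet (isConnectedSet_support P))
  simp only [List.mem_toFinset] at hy hmin
  obtain ⟨q, hq, hlen⟩ := hG.exists_path_of_dist x y
  have hq_mem : ∀ z ∈ q.support, z ∈ P.support → z = y := fun z hz hzP => by
    have hsum := dist_add_dist_of_mem_support hlen hz
    have := hmin x hx z hzP
    exact hG.dist_eq_zero_iff.mp (by omega)
  refine ⟨S ∪ q.support.toFinset ∪ P.support.toFinset, mem_spanningSets.mpr ⟨?_, ?_, ?_⟩,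
    subset_union_right, G.dist x y, ⟨x, y, rfl⟩, ?_, ?_, ?_⟩
  · refine isConnectedSet_union (x := y) (isConnectedSet_union (x := x) hS
      (isConnectedSet_support q) hx ?_) (isConnectedSet_support P) ?_ ?_ <;> simp [hy]
  · simp
  · simp
  · exact hG.pos_dist_of_ne fun h => havoid x hx (h ▸ hy)
  · have hsub : q.support.toFinset.erase y ⊆
        (S ∪ q.support.toFinset ∪ P.support.toFinset) \ P.support.toFinset := fun z hz => by
      rw [mem_erase, List.mem_toFinset] at hz
      simp only [mem_sdiff, mem_union, List.mem_toFinset]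
      exact ⟨Or.inl (Or.inr hz.2), fun hzP => hz.1 (hq_mem z hz.2 hzP)⟩
    have hcard := card_le_card hsub
    rw [card_erase_of_mem (List.mem_toFinset.mpr q.end_mem_support),
      List.toFinset_card_of_nodup hq.support_nodup, q.length_support, hlen] at hcard
    exact hcard
  · ext z
    simp only [mem_filter, mem_union, List.mem_toFinset]
    refine ⟨?_, fun hz => ⟨Or.inl (Or.inl hz), hmin z hz⟩⟩
    rintro ⟨(hz | hz) | hz, hfar⟩
    · exact hz
    · have hsum := dist_add_dist_of_mem_support hlen hz
      have := hfar y hy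
      exact hG.dist_eq_zero_iff.mp (by omega : G.dist x z = 0) ▸ hx
    · have hxy := hfar z hz
      rw [dist_self, Nat.le_zero, hG.dist_eq_zero_iff] at hxy
      exact absurd (hxy ▸ hy) (havoid x hx)

/-- The number of distances `c ≥ 1` at which a connected set avoiding `P` may have been attached to
`P` so as to form the connected set `T`; it bounds the number of such sets charged to `T`. -/
def numAttachments (P : G.Walk u w) (T : Finset V) : ℕ :=
  if P.support.toFinset ⊆ T then min P.length #(T \ P.support.toFinset) else 0

lemma card_connectedSets_avoiding_le_sum (hG : G.Connected) (hD : ∀ x y, G.dist x y ≤ P.length) :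
    #{S ∈ G.connectedSets | ¬ ∃ x ∈ S, x ∈ P.support} ≤
      ∑ T ∈ spanningSets G u w, numAttachments P T := by
  have hsigma : ∑ T ∈ spanningSets G u w, numAttachments P T =
      #((spanningSets G u w).sigma fun T => Icc 1 (numAttachments P T)) := by
    simp only [card_sigma, Nat.card_Icc, Nat.add_sub_cancel]
  rw [hsigma]
  refine card_le_card_of_surjOn
    (fun x => {z ∈ x.1 | ∀ y ∈ P.support, x.2 ≤ G.dist z y}) fun S hS => ?_
  rw [mem_coe, mem_filter, mem_connectedSets] at hS
  obtain ⟨T, hT, hPT, c, ⟨x, y, hc⟩, hc1, hcT, rfl⟩ :=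
    exists_spanningSet_of_forall_notMem_support hG hS.1 (by simpa using hS.2)
  refine ⟨⟨T, c⟩, ?_, rfl⟩
  rw [mem_coe, mem_sigma, mem_Icc, numAttachments, if_pos hPT]
  exact ⟨hT, hc1, le_min (hc ▸ hD x y) hcT⟩

lemma numConnectedSets_le_sum (hG : G.Connected) (hP : P.IsPath)
    (hD : ∀ x y, G.dist x y ≤ P.length) :
    G.numConnectedSets ≤
      ∑ T ∈ spanningSets G u w, ((trimDiagram hP T).card + numAttachments P T) := by
  rw [sum_add_distrib, ← card_connectedSets_meeting_eq_sum, numConnectedSets,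
    ← card_filter_add_card_filter_not (fun S => ∃ x ∈ S, x ∈ P.support)]
  gcongr
  exact card_connectedSets_avoiding_le_sum hG hD

end Counting

section Estimates

variable [DecidableEq V] {u w : V} {P : G.Walk u w} {T : Finset V} {a b : ℕ}

lemma initialVerts_subset_support (P : G.Walk u w) (a : ℕ) :
    initialVerts P a ⊆ P.support.toFinset :=
  image_subset_iff.mpr fun i _ => List.mem_toFinset.mpr (P.getVert_mem_support i)

lemma mem_trim_of_notMem_support {x : V} (hx : x ∈ T) (hxP : x ∉ P.support) : x ∈ trim P T a b := by
  refine mem_sdiff.mpr ⟨hx, fun hmem => hxP (List.mem_toFinset.mp ?_)⟩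
  obtain hmem | hmem := mem_union.mp hmem
  · exact initialVerts_subset_support P a hmem
  · simpa using initialVerts_subset_support P.reverse b hmem

namespace IsTrimmable

lemma exists_dist_eq (hG : G.Connected) (hlen : P.length = G.dist u w)
    (h : IsTrimmable P T a b) {x y : V} (hx : x ∈ trim P T a b) (hy : y ∈ trim P T a b) {t : ℕ}
    (hxt : G.dist u x ≤ t) (hty : t ≤ G.dist u y) (ht : t < a ∨ P.length < t + b) :
    ∃ z ∈ T \ P.support.toFinset, G.dist u z = t := by
  obtain ⟨z, hz, hzt⟩ := exists_mem_apply_eq_of_isConnectedSet h.connected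
    (fun _ _ => dist_le_dist_add_one_of_adj hG u) hx hy hxt hty
  refine ⟨z, mem_sdiff.mpr ⟨(mem_sdiff.mp hz).1, fun hzP => ?_⟩, hzt⟩
  obtain ⟨k, rfl, hk⟩ := Walk.mem_support_iff_exists_getVert.mp (List.mem_toFinset.mp hzP)
  rw [getVert_mem_trim (P.isPath_of_length_eq_dist hlen) hk h.add_le] at hz
  rw [dist_getVert_of_length_eq_dist hlen hk] at hzt
  omega

lemma support_subset (ha : IsTrimmable P T a 0) (hb : IsTrimmable P T 0 b)
    (hab : P.length < a + b) : P.support.toFinset ⊆ T := by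
  intro x hx
  obtain ⟨k, rfl, hk⟩ := Walk.mem_support_iff_exists_getVert.mp (List.mem_toFinset.mp hx)
  obtain hka | hka := le_or_gt k a
  · exact ha.left (mem_initialVerts.mpr ⟨k, by omega, rfl⟩)
  · refine hb.right (mem_initialVerts.mpr ⟨P.length - k, by omega, ?_⟩)
    rw [P.getVert_reverse, Nat.sub_sub_self hk]

-- For `P.length - b < t < a` the vertex of `P` at distance `t` from `u` is deleted in both
-- trimmed sets. One of them joins `u` to `z` and the other joins `z` to `w`, and one of these
-- connections has to pass through the level `t`, hence outside `P`.
lemma add_le_of_support_ssubset (hG : G.Connected) (hlen : P.length = G.dist u w)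
    (ha : IsTrimmable P T a 0) (hb : IsTrimmable P T 0 b) (hT : P.support.toFinset ⊂ T) :
    a + b ≤ P.length + 1 + #(T \ P.support.toFinset) := by
  have hP := P.isPath_of_length_eq_dist hlen
  obtain ⟨z, hzT, hzP⟩ := exists_of_ssubset hT
  rw [List.mem_toFinset] at hzP
  have hza : z ∈ trim P T a 0 := mem_trim_of_notMem_support hzT hzP
  have hzb : z ∈ trim P T 0 b := mem_trim_of_notMem_support hzT hzP
  have hwa : w ∈ trim P T a 0 := by
    simpa [trim_reverse] using ha.reverse.getVert_mem_trim_left hP.reverse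
  have hub : u ∈ trim P T 0 b := by
    simpa using hb.getVert_mem_trim_left hP
  have hsub : Ioo (P.length - b) a ⊆ (T \ P.support.toFinset).image (G.dist u) := by
    intro t ht
    rw [mem_Ioo] at ht
    rw [mem_image]
    obtain htz | htz := le_total t (G.dist u z)
    · exact hb.exists_dist_eq hG hlen hub hzb (by simp) htz (by omega)
    · refine ha.exists_dist_eq hG hlen hza hwa htz ?_ (by omega)
      have := ha.add_le
      omega
  have hcard := (card_le_card hsub).trans card_image_le
  have hb_le := hb.add_le
  rw [Nat.card_Ioo] at hcard
  omega

end IsTrimmable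

lemma isTrimmable_support_iff (hP : P.IsPath) :
    IsTrimmable P P.support.toFinset a b ↔ a + b < P.length + 1 := by
  refine ⟨fun h => Nat.lt_succ_of_le h.add_le, fun hab => ?_⟩
  suffices h : IsTrimmable P P.support.toFinset a (P.length - a) from
    h.of_le hP le_rfl (by omega)
  have hright := initialVerts_subset_support P.reverse (P.length - a + 1)
  rw [P.support_reverse, List.toFinset_reverse] at hright
  refine ⟨by omega, initialVerts_subset_support P (a + 1), hright, ?_⟩
  have hsingleton : trim P P.support.toFinset a (P.length - a) = {P.getVert a} := by
    refine Subset.antisymm (fun x hx => ?_) (singleton_subset_iff.mpr ?_)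
    · obtain ⟨k, rfl, hk⟩ :=
        Walk.mem_support_iff_exists_getVert.mp (List.mem_toFinset.mp (mem_sdiff.mp hx).1)
      rw [getVert_mem_trim hP hk (by omega)] at hx
      rw [show k = a by omega, mem_singleton]
    · exact (getVert_mem_trim hP (by omega) (by omega)).mpr
        ⟨List.mem_toFinset.mpr (P.getVert_mem_support a), le_rfl, by omega⟩
  rw [hsingleton]
  exact isConnectedSet_singleton _

lemma exists_colLen_trimDiagram_eq_add_one (hP : P.IsPath) (hT : IsTrimmable P T 0 0) :
    ∃ a, IsTrimmable P T a 0 ∧ (trimDiagram hP T).colLen 0 = a + 1 := by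
  have hpos := YoungDiagram.mem_iff_lt_colLen.mp ((mem_trimDiagram hP).mpr hT)
  refine ⟨(trimDiagram hP T).colLen 0 - 1, ?_, by omega⟩
  rw [← mem_trimDiagram hP, YoungDiagram.mem_iff_lt_colLen]
  omega

lemma exists_rowLen_trimDiagram_eq_add_one (hP : P.IsPath) (hT : IsTrimmable P T 0 0) :
    ∃ b, IsTrimmable P T 0 b ∧ (trimDiagram hP T).rowLen 0 = b + 1 := by
  obtain ⟨b, hb, hcol⟩ := exists_colLen_trimDiagram_eq_add_one hP.reverse hT.reverse
  rw [trimDiagram_reverse hP, YoungDiagram.colLen_transpose] at hcol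
  exact ⟨b, by simpa only [P.reverse_reverse] using hb.reverse, hcol⟩

lemma two_le_colLen_add_rowLen (hP : P.IsPath) (hT : IsTrimmable P T 0 0) :
    2 ≤ (trimDiagram hP T).colLen 0 + (trimDiagram hP T).rowLen 0 := by
  obtain ⟨a, -, ha⟩ := exists_colLen_trimDiagram_eq_add_one hP hT
  obtain ⟨b, -, hb⟩ := exists_rowLen_trimDiagram_eq_add_one hP hT
  omega

lemma colLen_add_rowLen_le_of_support_ssubset (hG : G.Connected) (hP : P.IsPath)
    (hlen : P.length = G.dist u w) (hT : IsTrimmable P T 0 0) (hPT : P.support.toFinset ⊂ T) :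
    (trimDiagram hP T).colLen 0 + (trimDiagram hP T).rowLen 0 ≤
      P.length + 3 + #(T \ P.support.toFinset) := by
  obtain ⟨a, ha, hcol⟩ := exists_colLen_trimDiagram_eq_add_one hP hT
  obtain ⟨b, hb, hrow⟩ := exists_rowLen_trimDiagram_eq_add_one hP hT
  have := ha.add_le_of_support_ssubset hG hlen hb hPT
  omega

lemma colLen_add_rowLen_le_of_not_support_subset (hP : P.IsPath) (hT : IsTrimmable P T 0 0)
    (hPT : ¬ P.support.toFinset ⊆ T) :
    (trimDiagram hP T).colLen 0 + (trimDiagram hP T).rowLen 0 ≤ P.length + 2 := by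
  obtain ⟨a, ha, hcol⟩ := exists_colLen_trimDiagram_eq_add_one hP hT
  obtain ⟨b, hb, hrow⟩ := exists_rowLen_trimDiagram_eq_add_one hP hT
  have := mt (ha.support_subset hb) hPT
  omega

lemma four_mul_youngDiagram_card_trimDiagram_add_le (hP : P.IsPath) (hT : IsTrimmable P T 0 0) :
    4 * ((trimDiagram hP T).card +
        ((trimDiagram hP T).colLen 0 + (trimDiagram hP T).rowLen 0)) ≤
      ((trimDiagram hP T).colLen 0 + (trimDiagram hP T).rowLen 0) ^ 2 + 4 * (P.length + 2) :=
  four_mul_youngDiagram_card_add_le ((mem_trimDiagram hP).mpr hT)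
    fun _ _ h => ((mem_trimDiagram hP).mp h).add_le

lemma four_mul_add_le_of_sq_bounds {D m k c E s : ℕ} (hD : 1 ≤ D) (hkm : k + 1 ≤ m) (hED : E ≤ D)
    (hEk : E ≤ k) (hs2 : 2 ≤ s) (hs : s ≤ D + 3 + k) (hsq : 4 * c ≤ s ^ 2)
    (hsq' : 4 * (c + s) ≤ s ^ 2 + 4 * (D + 2)) : 4 * (c + E) ≤ (D + 2 + m) * s := by
  zify at *
  obtain hsD | hsD := le_or_gt (s : ℤ) (D + 2)
  · have hE : 4 * (E : ℤ) ≤ s * (D + 2 - s + m) := by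
      obtain rfl | rfl | h4 : s = 2 ∨ s = 3 ∨ 4 ≤ s := by omega
      · push_cast
        linarith
      · push_cast
        linarith
      · zify at h4
        exact mul_le_mul h4 (by linarith) (by positivity) (by positivity)
    linarith
  · have hm : (4 : ℤ) * (m - (s - D - 2)) ≤ s * (m - (s - D - 2)) :=
      mul_le_mul_of_nonneg_right (by linarith) (by linarith)
    linarith

lemma four_mul_add_lt_of_sq_bounds {D m c E s : ℕ} (hD : 1 ≤ D) (hm : 1 ≤ m) (hEm : E ≤ m)
    (hs2 : 2 ≤ s) (hs : s ≤ D + 3 + m) (hsq : 4 * c ≤ s ^ 2)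
    (hsq' : 4 * (c + s) ≤ s ^ 2 + 4 * (D + 2)) :
    4 * (c + E) < (D + 2 + m) * s + 2 * (D + 1) * m := by
  zify at *
  have hDm : (m : ℤ) ≤ D * m := le_mul_of_one_le_left (by linarith) hD
  obtain hsD | hsD := le_or_gt (s : ℤ) (D + 2)
  · have hpos : (0 : ℤ) < s * (D + 2 - s + m) := mul_pos (by linarith) (by linarith)
    linarith
  obtain hlt | rfl := (Nat.cast_le.mp (by exact_mod_cast hs) : s ≤ D + 3 + m).lt_or_eq
  · have hle : (4 : ℤ) * (m - (s - D - 2)) ≤ s * (m - (s - D - 2)) :=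
      mul_le_mul_of_nonneg_right (by linarith) (by zify at hlt; linarith)
    linarith
  · have hDm' : (D : ℤ) ≤ D * m := le_mul_of_one_le_right (by linarith) hm
    push_cast at *
    linarith

lemma numAttachments_le_card_sdiff : numAttachments P T ≤ #(T \ P.support.toFinset) := by
  rw [numAttachments]
  split_ifs
  exacts [min_le_right _ _, Nat.zero_le _]

lemma numAttachments_le_length : numAttachments P T ≤ P.length := by
  rw [numAttachments]
  split_ifs
  exacts [min_le_left _ _, Nat.zero_le _]

variable [Fintype V]

/-- How much the contributions of `T` to `N(G; u)` and `N(G; w)`, scaled by `n + 1`, exceed four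
times the bound on the number of connected sets charged to `T`. -/
noncomputable def surplus (hP : P.IsPath) (T : Finset V) : ℤ :=
  (Fintype.card V + 1) * ((trimDiagram hP T).colLen 0 + (trimDiagram hP T).rowLen 0) -
    4 * ((trimDiagram hP T).card + numAttachments P T)

lemma four_mul_numConnectedSets_add_sum_surplus_le (hG : G.Connected) (hP : P.IsPath)
    (hD : ∀ x y, G.dist x y ≤ P.length) :
    4 * (G.numConnectedSets : ℤ) + ∑ T ∈ spanningSets G u w, surplus hP T ≤
      (Fintype.card V + 1) * (G.numConnectedSetsAt w + G.numConnectedSetsAt u) := by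
  have hN : (G.numConnectedSets : ℤ) ≤ _ := Nat.cast_le.mpr (numConnectedSets_le_sum hG hP hD)
  rw [numConnectedSetsAt_eq_sum_rowLen hP, numConnectedSetsAt_eq_sum_colLen hP]
  push_cast at hN ⊢
  simp only [surplus, sum_sub_distrib, ← mul_sum, sum_add_distrib] at hN ⊢
  linarith

lemma surplus_nonneg (hG : G.Connected) (hP : P.IsPath) (hlen : P.length = G.dist u w)
    (hD : 1 ≤ P.length) (hn : P.length + 1 < Fintype.card V) (hT : T ∈ spanningSets G u w)
    (hTP : T ≠ P.support.toFinset) (hTV : T ≠ univ) : 0 ≤ surplus hP T := by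
  have hT : IsTrimmable P T 0 0 := isTrimmable_zero_zero.mpr (mem_spanningSets.mp hT)
  obtain ⟨k, hkn, hEk, hs⟩ : ∃ k, P.length + 1 + (k + 1) ≤ Fintype.card V ∧
      numAttachments P T ≤ k ∧
      (trimDiagram hP T).colLen 0 + (trimDiagram hP T).rowLen 0 ≤ P.length + 3 + k := by
    by_cases hsub : P.support.toFinset ⊆ T
    · refine ⟨#(T \ P.support.toFinset), ?_, numAttachments_le_card_sdiff,
        colLen_add_rowLen_le_of_support_ssubset hG hP hlen hT (hsub.ssubset_of_ne hTP.symm)⟩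
      have hlt := card_univ (α := V) ▸ card_lt_card (ssubset_univ_iff.mpr hTV)
      have hcard := card_sdiff_add_card_eq_card hsub
      rw [List.toFinset_card_of_nodup hP.support_nodup, P.length_support] at hcard
      omega
    · have hs := colLen_add_rowLen_le_of_not_support_subset hP hT hsub
      exact ⟨0, hn, by rw [numAttachments, if_neg hsub], by omega⟩
  obtain ⟨m, hm⟩ := Nat.exists_eq_add_of_le hn.le
  have hle := four_mul_add_le_of_sq_bounds hD (by omega : k + 1 ≤ m) numAttachments_le_length hEk
    (two_le_colLen_add_rowLen hP hT) hs (four_mul_youngDiagram_card_le_sq _)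
    (four_mul_youngDiagram_card_trimDiagram_add_le hP hT)
  rw [surplus, hm, sub_nonneg]
  zify at hle
  push_cast
  linarith

lemma neg_lt_surplus_univ (hG : G.Connected) (hP : P.IsPath) (hlen : P.length = G.dist u w)
    (hD : 1 ≤ P.length) {m : ℕ} (hm : 1 ≤ m) (hn : Fintype.card V = P.length + 1 + m) :
    -(2 * (P.length + 1) * m : ℤ) < surplus hP univ := by
  have hT : IsTrimmable P univ 0 0 :=
    isTrimmable_zero_zero.mpr ⟨isConnectedSet_univ hG, mem_univ u, mem_univ w⟩
  have hsupp : #P.support.toFinset = P.length + 1 := by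
    rw [List.toFinset_card_of_nodup hP.support_nodup, P.length_support]
  have hsdiff : #(univ \ P.support.toFinset) = m := by
    rw [card_univ_sdiff, hsupp, hn, Nat.add_sub_cancel_left]
  have hssub : P.support.toFinset ⊂ univ := ssubset_univ_iff.mpr fun h => by
    rw [h, card_univ] at hsupp
    omega
  have hE : numAttachments P univ ≤ m := hsdiff ▸ numAttachments_le_card_sdiff
  have hs := colLen_add_rowLen_le_of_support_ssubset hG hP hlen hT hssub
  rw [hsdiff] at hs
  have hlt := four_mul_add_lt_of_sq_bounds hD hm hE (two_le_colLen_add_rowLen hP hT) hs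
    (four_mul_youngDiagram_card_le_sq _) (four_mul_youngDiagram_card_trimDiagram_add_le hP hT)
  rw [surplus, hn]
  zify at hlt
  push_cast
  linarith

lemma surplus_support (hP : P.IsPath) {m : ℕ} (hn : Fintype.card V = P.length + 1 + m) :
    surplus hP P.support.toFinset = 2 * (P.length + 1) * m := by
  have hμ : ∀ a b, (a, b) ∈ trimDiagram hP P.support.toFinset ↔ a + b < P.length + 1 :=
    fun a b => (mem_trimDiagram hP).trans (isTrimmable_support_iff hP)
  have hcard := two_mul_card_eq_of_mem_iff_add_lt hμ
  have hatt : numAttachments P P.support.toFinset = 0 := by simp [numAttachments]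
  rw [surplus, colLen_zero_eq_of_mem_iff_add_lt hμ, rowLen_zero_eq_of_mem_iff_add_lt hμ, hatt, hn]
  zify at hcard
  push_cast
  linear_combination -2 * hcard

end Estimates

section Diametral

variable {u w : V} {P : G.Walk u w}

lemma isDiametral_reverse (hP : P.IsDiametral) : P.reverse.IsDiametral :=
  ⟨hP.1.reverse, by rw [P.length_reverse, dist_comm, hP.2.1], by rw [dist_comm, hP.2.2]⟩

lemma dist_le_length_of_isDiametral [Finite V] (hG : G.Connected) (hP : P.IsDiametral) (x y : V) :
    G.dist x y ≤ P.length := by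
  have := hG.nonempty
  rw [hP.2.1, hP.2.2]
  exact dist_le_diam (connected_iff_ediam_ne_top.mp hG)

lemma ne_of_isDiametral [Finite V] [Nontrivial V] (hG : G.Connected) (hP : P.IsDiametral) :
    u ≠ w := fun h => by
  have := hP.2.2
  rw [h, dist_self] at this
  exact connected_iff_diam_ne_zero.mp hG this.symm

lemma connected_induce_compl_end_of_isDiametral [Finite V] [Nontrivial V] (hG : G.Connected)
    (hP : P.IsDiametral) : (G.induce ({w}ᶜ : Set V)).Connected :=
  connected_induce_compl_singleton_of_dist_le hG (ne_of_isDiametral hG hP) fun z =>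
    hP.2.1 ▸ dist_le_length_of_isDiametral hG hP u z

lemma connected_induce_compl_start_of_isDiametral [Finite V] [Nontrivial V] (hG : G.Connected)
    (hP : P.IsDiametral) : (G.induce ({u}ᶜ : Set V)).Connected :=
  connected_induce_compl_end_of_isDiametral hG (isDiametral_reverse hP)

variable [Fintype V]

lemma four_mul_numConnectedSets_lt_of_isDiametral (hG : G.Connected) (hP : P.IsDiametral)
    (hn : P.length + 1 < Fintype.card V) :
    4 * G.numConnectedSets <
      (Fintype.card V + 1) * (G.numConnectedSetsAt w + G.numConnectedSetsAt u) := by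
  classical
  have : Nontrivial V := Fintype.one_lt_card_iff_nontrivial.mp (by omega)
  obtain ⟨hpath, hlen, -⟩ := id hP
  have hlen_pos : 1 ≤ P.length := hlen ▸ hG.pos_dist_of_ne (ne_of_isDiametral hG hP)
  obtain ⟨m, hm⟩ := Nat.exists_eq_add_of_le hn.le
  have hsupp : P.support.toFinset ∈ spanningSets G u w :=
    mem_spanningSets.mpr ⟨isConnectedSet_support P, by simp, by simp⟩
  have huniv : univ ∈ (spanningSets G u w).erase P.support.toFinset := by
    refine mem_erase.mpr ⟨fun h => ?_, mem_spanningSets.mpr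
      ⟨isConnectedSet_univ hG, mem_univ u, mem_univ w⟩⟩
    have hcard := List.toFinset_card_of_nodup hpath.support_nodup
    rw [← h, card_univ, P.length_support] at hcard
    omega
  have hrest : 0 ≤ ∑ T ∈ ((spanningSets G u w).erase P.support.toFinset).erase univ,
      surplus hpath T := sum_nonneg fun T hT => by
    simp only [mem_erase] at hT
    exact surplus_nonneg hG hpath hlen hlen_pos hn hT.2.2 hT.2.1 hT.1
  have hpos : 0 < ∑ T ∈ spanningSets G u w, surplus hpath T := by
    rw [← add_sum_erase _ _ hsupp, ← add_sum_erase _ _ huniv, surplus_support hpath hm]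
    linarith [neg_lt_surplus_univ hG hpath hlen hlen_pos (by omega) hm]
  have hle := four_mul_numConnectedSets_add_sum_surplus_le hG hpath
    (dist_le_length_of_isDiametral hG hP)
  zify
  linarith

end Diametral

section PathGraph

variable [Fintype V] [DecidableEq V] {u w : V} {P : G.Walk u w}

lemma isPathGraph_of_isHamiltonian (hG : G.Connected) (hlen : P.length = G.dist u w)
    (hP : P.IsHamiltonian) : G.IsPathGraph := by
  have e : pathGraph P.support.length ≃g G := ⟨hP.getVertEquiv, fun {i j} => by
    have hi := i.2.trans_eq P.length_support
    have hj := j.2.trans_eq P.length_support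
    exact (adj_getVert_iff_of_length_eq_dist hG hlen (by omega) (by omega)).trans
      pathGraph_adj.symm⟩
  rw [hP.length_support] at e
  exact ⟨e.symm⟩

lemma isHamiltonian_of_isPathGraph (hG : G.Connected) (hP : P.IsDiametral)
    (hpath : G.IsPathGraph) : P.IsHamiltonian := by
  obtain ⟨e⟩ := hpath
  have hV : 0 < Fintype.card V := Fintype.card_pos_iff.mpr hG.nonempty
  obtain ⟨q, hq, hlen⟩ :=
    hG.exists_path_of_dist (e.symm ⟨0, hV⟩) (e.symm ⟨Fintype.card V - 1, by omega⟩)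
  have hadj : ∀ x y, G.Adj x y → (e y).val ≤ (e x).val + 1 := fun x y hxy => by
    have := pathGraph_adj.mp (e.map_adj_iff.mpr hxy)
    omega
  have hq : q.IsHamiltonian := hq.isHamiltonian_of_mem fun x => by
    obtain ⟨z, hz, hzx⟩ := exists_mem_apply_eq_of_isConnectedSet (isConnectedSet_support q) hadj
      (List.mem_toFinset.mpr q.start_mem_support) (List.mem_toFinset.mpr q.end_mem_support)
      (t := (e x).val) (by simp) (by simpa using Nat.le_sub_one_of_lt (e x).2)
    rw [← e.injective (Fin.ext hzx)]
    exact List.mem_toFinset.mp hz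
  have hle : q.length ≤ P.length := hlen ▸ dist_le_length_of_isDiametral hG hP _ _
  have hlt := hP.1.length_lt
  rw [hq.length_eq] at hle
  exact Walk.isHamiltonian_iff_isPath_and_length_eq.mpr ⟨hP.1, by omega⟩

lemma isPathGraph_iff_isHamiltonian (hG : G.Connected) (hP : P.IsDiametral) :
    G.IsPathGraph ↔ P.IsHamiltonian :=
  ⟨isHamiltonian_of_isPathGraph hG hP, isPathGraph_of_isHamiltonian hG hP.2.1⟩

lemma spanningSets_eq_singleton_of_isHamiltonian (hG : G.Connected) (hlen : P.length = G.dist u w)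
    (hP : P.IsHamiltonian) : spanningSets G u w = {univ} := by
  refine eq_singleton_iff_unique_mem.mpr ⟨mem_spanningSets.mpr
    ⟨isConnectedSet_univ hG, mem_univ u, mem_univ w⟩, fun T hT => eq_univ_of_forall fun x => ?_⟩
  obtain ⟨hT, hu, hw⟩ := mem_spanningSets.mp hT
  obtain ⟨i, rfl, hi⟩ := Walk.mem_support_iff_exists_getVert.mp (hP.mem_support x)
  obtain ⟨z, hz, hzi⟩ := exists_mem_apply_eq_of_isConnectedSet hT
    (fun _ _ => dist_le_dist_add_one_of_adj hG u) hu hw (t := i) (by simp) (hlen ▸ hi)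
  obtain ⟨j, rfl, hj⟩ := Walk.mem_support_iff_exists_getVert.mp (hP.mem_support z)
  rw [dist_getVert_of_length_eq_dist hlen hj] at hzi
  exact hzi ▸ hz

lemma two_mul_numConnectedSets_eq_of_isHamiltonian (hG : G.Connected)
    (hlen : P.length = G.dist u w) (hP : P.IsHamiltonian) :
    2 * G.numConnectedSets = (Fintype.card V + 1) * G.numConnectedSetsAt u := by
  have hμ : ∀ a b, (a, b) ∈ trimDiagram hP.isPath univ ↔ a + b < Fintype.card V := fun a b => by
    rw [mem_trimDiagram, ← hP.toFinset_support, isTrimmable_support_iff hP.isPath,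
      ← P.length_support, hP.length_support]
  have hmeet : {S ∈ G.connectedSets | ∃ x ∈ S, x ∈ P.support} = G.connectedSets :=
    filter_true_of_mem fun S hS =>
      (nonempty_of_isConnectedSet (mem_connectedSets.mp hS)).imp fun x hx => ⟨hx, hP.mem_support x⟩
  rw [numConnectedSets, ← hmeet, card_connectedSets_meeting_eq_sum hP.isPath,
    numConnectedSetsAt_eq_sum_rowLen hP.isPath,
    spanningSets_eq_singleton_of_isHamiltonian hG hlen hP, sum_singleton, sum_singleton,
    two_mul_card_eq_of_mem_iff_add_lt hμ, rowLen_zero_eq_of_mem_iff_add_lt hμ, mul_comm]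

end PathGraph

lemma exists_endpoint_two_mul_numConnectedSets_le [Fintype V] (hG : G.Connected) {u w : V}
    {P : G.Walk u w} (hP : P.IsDiametral) :
    ∃ v, (v = u ∨ v = w) ∧
      2 * G.numConnectedSets ≤ (Fintype.card V + 1) * G.numConnectedSetsAt v ∧
      ((Fintype.card V + 1) * G.numConnectedSetsAt v = 2 * G.numConnectedSets ↔
        G.IsPathGraph) := by
  classical
  rw [isPathGraph_iff_isHamiltonian hG hP]
  by_cases hH : P.IsHamiltonian
  · have heq := two_mul_numConnectedSets_eq_of_isHamiltonian hG hP.2.1 hH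
    exact ⟨u, Or.inl rfl, heq.le, iff_of_true heq.symm hH⟩
  · have hn : P.length + 1 < Fintype.card V := by
      have hne := mt (fun h => Walk.isHamiltonian_iff_isPath_and_length_eq.mpr ⟨hP.1, h⟩) hH
      have hlt := hP.1.length_lt
      omega
    have hlt := four_mul_numConnectedSets_lt_of_isDiametral hG hP hn
    obtain ⟨v, hv, hvlt⟩ : ∃ v, (v = u ∨ v = w) ∧
        2 * G.numConnectedSets < (Fintype.card V + 1) * G.numConnectedSetsAt v := by
      by_contra! hle
      linarith [hle u (Or.inl rfl), hle w (Or.inr rfl)]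
    exact ⟨v, hv, hvlt.le, iff_of_false hvlt.ne' hH⟩

end DiametralPath

theorem lemma2 {V : Type*} [Fintype V] (G : SimpleGraph V) (hG : G.Connected)
    (hn : 3 ≤ Fintype.card V) :
    (∃ v : V, (∃ (w : V) (P : G.Walk v w), P.IsDiametral) ∧
      (G.induce ({v}ᶜ : Set V)).Connected ∧
      2 * (G.numConnectedSets : ℚ) / ((Fintype.card V : ℚ) + 1) ≤ (G.numConnectedSetsAt v : ℚ) ∧
      ((G.numConnectedSetsAt v : ℚ) = 2 * (G.numConnectedSets : ℚ) / ((Fintype.card V : ℚ) + 1) ↔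
        G.IsPathGraph)) ∧
    (∀ (u w : V) (P : G.Walk u w), P.IsDiametral → ∃ v : V, (v = u ∨ v = w) ∧
      (G.induce ({v}ᶜ : Set V)).Connected ∧
      2 * (G.numConnectedSets : ℚ) / ((Fintype.card V : ℚ) + 1) ≤ (G.numConnectedSetsAt v : ℚ) ∧
      ((G.numConnectedSetsAt v : ℚ) = 2 * (G.numConnectedSets : ℚ) / ((Fintype.card V : ℚ) + 1) ↔
        G.IsPathGraph)) := by
  have : Nontrivial V := Fintype.one_lt_card_iff_nontrivial.mp (by omega)
  refine (and_iff_right_of_imp fun hends => ?_).mpr fun u w P hP => ?_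
  · obtain ⟨u, w, huw⟩ := G.exists_dist_eq_diam
    obtain ⟨P, hP, hlen⟩ := hG.exists_path_of_dist u w
    have hdiam : P.IsDiametral := ⟨hP, hlen, huw⟩
    obtain ⟨v, rfl | rfl, hv⟩ := hends u w P hdiam
    · exact ⟨v, ⟨w, P, hdiam⟩, hv⟩
    · exact ⟨v, ⟨u, P.reverse, isDiametral_reverse hdiam⟩, hv⟩
  · obtain ⟨v, hv, hle, heq⟩ := exists_endpoint_two_mul_numConnectedSets_le hG hP
    have hpos : (0 : ℚ) < Fintype.card V + 1 := by positivity
    refine ⟨v, hv, ?_, ?_, ?_⟩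
    · obtain rfl | rfl := hv
      · exact connected_induce_compl_start_of_isDiametral hG hP
      · exact connected_induce_compl_end_of_isDiametral hG hP
    · rw [div_le_iff₀' hpos]
      exact_mod_cast hle
    · rw [eq_div_iff hpos.ne', mul_comm, ← heq]
      norm_cast
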